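/- There exists an analytic ($\Sigma^1_1$) set $E \subseteq \mathbb{R}$ such that for every set $Z \subseteq \mathbb{R}$ which has Lebesgue measure zero or is meager there exists $x \in \mathbb{R}$ such that $E \setminus (x+Z)$ is not Borel, where $x+Z=\{x+z : z\in Z\}$. -/

import Mathlib

open Set Topology MeasureTheory Cardinal

/-! Spread a universal analytic set `U` over the line by an injection `(c, a) ↦ t c + k a`; its
image `E` contains a translate of `k '' A` for every analytic `A`. For small `Z`, some `x` makes `k
a - x` avoid `Z` on an uncountable Borel set `B`. Pick a non-Borel analytic `A ⊆ B` and a code `c`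
of `A`: inside `B`, the preimage of `E \ (t c + x + Z)` under `a ↦ t c + k a` is exactly `A`. -/

instance polishSpace_natBool : PolishSpace (ℕ → Bool) := by
  let := TopologicalSpace.metrizableSpaceMetric (ℕ → Bool)
  infer_instance

/-- For every second countable space `X` there is an analytic subset of `2^ℕ × X` whose sections are
exactly the analytic subsets of `X`. -/
theorem exists_universal_analyticSet (X : Type*) [TopologicalSpace X] [PolishSpace X] :
    ∃ U : Set ((ℕ → Bool) × X), AnalyticSet U ∧
      ∀ A : Set X, AnalyticSet A → ∃ c, {a | (c, a) ∈ U} = A := by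
  let b := TopologicalSpace.countableBasis (X × (ℕ → ℕ))
  have hb : TopologicalSpace.IsTopologicalBasis b := TopologicalSpace.isBasis_countableBasis _
  obtain ⟨B, hB⟩ : ∃ B : ℕ → Set (X × (ℕ → ℕ)), insert ∅ b = range B :=
    ((TopologicalSpace.countable_countableBasis _).insert ∅).exists_eq_range (insert_nonempty _ _)
  have hopen : ∀ n, IsOpen (B n) := fun n => by
    have : B n ∈ insert ∅ b := hB ▸ mem_range_self n
    rcases this with h | h
    · rw [h]; exact isOpen_empty
    · exact hb.isOpen h
  let F : Set (((ℕ → Bool) × X) × (ℕ → ℕ)) := {p | ∀ n, p.1.1 n = true → (p.1.2, p.2) ∉ B n}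
  have hF : IsClosed F := by
    simp only [F, Set.ofPred_forall, imp_iff_not_or]
    refine isClosed_iInter fun n => IsClosed.union ?_ ?_
    · exact (isClopen_discrete {b : Bool | ¬ b = true}).isClosed.preimage
        (f := fun p : ((ℕ → Bool) × X) × (ℕ → ℕ) => p.1.1 n) (by fun_prop)
    · exact (hopen n).isClosed_compl.preimage
        (f := fun p : ((ℕ → Bool) × X) × (ℕ → ℕ) => (p.1.2, p.2)) (by fun_prop)
  have key : ∀ C : Set (X × (ℕ → ℕ)), IsClosed C →
      ∃ c, {a | (c, a) ∈ Prod.fst '' F} = Prod.fst '' C := by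
    classical
    intro C hC
    -- The code of a closed set lists the basic open sets that miss it.
    refine ⟨fun n => decide (Disjoint (B n) C), ?_⟩
    have hmem : ∀ p, p ∈ C ↔ ∀ n, Disjoint (B n) C → p ∉ B n := by
      refine fun p => ⟨fun hp n hn hpn => hn.le_bot ⟨hpn, hp⟩, fun h => ?_⟩
      by_contra hp
      obtain ⟨v, hv, hpv, hvC⟩ := hb.exists_subset_of_mem_open (a := p) (u := Cᶜ) hp hC.isOpen_compl
      obtain ⟨n, rfl⟩ : v ∈ range B := hB ▸ mem_insert_of_mem _ hv
      exact h n (disjoint_left.2 hvC) hpv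
    ext a
    constructor
    · rintro ⟨⟨⟨c, a'⟩, β⟩, h, heq⟩
      simp only [Prod.mk.injEq] at heq
      obtain ⟨rfl, rfl⟩ := heq
      exact ⟨(a', β), (hmem _).2 fun n hn => h n (by simpa using hn), rfl⟩
    · rintro ⟨⟨a', β⟩, h, rfl⟩
      exact ⟨((_, a'), β), fun n hn => (hmem _).1 h n (by simpa using hn), rfl⟩
  refine ⟨Prod.fst '' F, hF.analyticSet.image_of_continuous continuous_fst, fun A hA => ?_⟩
  rw [AnalyticSet] at hA
  rcases hA with rfl | ⟨f, hf, rfl⟩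
  · simpa using key ∅ isClosed_empty
  · obtain ⟨c, hc⟩ := key {p | f p.2 = p.1} (isClosed_eq (by fun_prop) (by fun_prop))
    refine ⟨c, hc.trans ?_⟩
    ext a
    simp

/-- Cantor's diagonal argument on a universal set: a code of the diagonal's complement would
contradict itself. -/
theorem exists_analyticSet_not_measurableSet :
    ∃ A : Set (ℕ → Bool), AnalyticSet A ∧ ¬ MeasurableSet A := by
  obtain ⟨U, hU, huniv⟩ := exists_universal_analyticSet (ℕ → Bool)
  have hD : AnalyticSet {c | (c, c) ∈ U} := by
    have h : AnalyticSet (U ∩ {p | p.1 = p.2}) := by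
      rw [inter_eq_iInter]
      refine AnalyticSet.iInter fun b => ?_
      cases b
      · exact (isClosed_eq continuous_fst continuous_snd).analyticSet
      · exact hU
    convert h.image_of_continuous continuous_fst using 1
    ext c
    constructor
    · exact fun h => ⟨(c, c), ⟨h, rfl⟩, rfl⟩
    · rintro ⟨⟨c, d⟩, ⟨h, rfl : c = d⟩, rfl⟩
      exact h
  refine ⟨_, hD, fun hm => ?_⟩
  obtain ⟨c, hc⟩ := huniv _ hm.compl.analyticSet
  have : (c, c) ∈ U ↔ (c, c) ∉ U := (Set.ext_iff.1 hc c)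
  tauto

/-- Every uncountable Borel subset of the Cantor space contains an analytic set that is not
Borel. -/
theorem MeasurableSet.exists_analyticSet_subset_not_measurableSet {B : Set (ℕ → Bool)}
    (hB : MeasurableSet B) (hunc : ¬ B.Countable) :
    ∃ A ⊆ B, AnalyticSet A ∧ ¬ MeasurableSet A := by
  obtain ⟨A, hA, hAm⟩ := exists_analyticSet_not_measurableSet
  have := hB.standardBorel
  let e : B ≃ᵐ (ℕ → Bool) := PolishSpace.measurableEquivNatBoolOfNotCountable hunc
  have hemb : MeasurableEmbedding fun a => (e.symm a : ℕ → Bool) :=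
    (MeasurableEmbedding.subtype_coe hB).comp e.symm.measurableEmbedding
  refine ⟨(fun a => (e.symm a : ℕ → Bool)) '' A, ?_, ?_, fun h => hAm ?_⟩
  · rintro _ ⟨a, -, rfl⟩
    exact (e.symm a).2
  · rw [AnalyticSet] at hA
    rcases hA with rfl | ⟨f, hf, rfl⟩
    · simpa using analyticSet_empty
    · rw [← range_comp, ← image_univ]
      exact MeasurableSet.univ.analyticSet_image (hemb.measurable.comp hf.measurable)
  · exact hemb.measurableSet_image.1 h

/-- Fubini, with Cantor space parametrized by `ℝ` through a Borel isomorphism: for almost every `x`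
the bad parameters are null, so the good ones are uncountable. -/
theorem exists_measurableSet_not_countable_of_volume_eq_zero {φ : (ℕ → Bool) → ℝ}
    (hφ : Continuous φ) {Z : Set ℝ} (hZ : volume Z = 0) :
    ∃ (x : ℝ) (B : Set (ℕ → Bool)), MeasurableSet B ∧ ¬ B.Countable ∧ ∀ a ∈ B, φ a - x ∉ Z := by
  have hR : ¬ Countable ℝ := fun h => not_countable_real countable_univ
  let e : ℝ ≃ᵐ (ℕ → Bool) := PolishSpace.measurableEquivNatBoolOfNotCountable hR
  let N := toMeasurable volume Z
  have hN : MeasurableSet N := measurableSet_toMeasurable _ _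
  have hN0 : volume N = 0 := by rw [measure_toMeasurable, hZ]
  have hm : MeasurableSet {p : ℝ × ℝ | φ (e p.1) - p.2 ∈ N} :=
    hN.preimage (f := fun p : ℝ × ℝ => φ (e p.1) - p.2)
      ((hφ.measurable.comp (e.measurable.comp measurable_fst)).sub measurable_snd)
  have h0 : (volume.prod volume) {p : ℝ × ℝ | φ (e p.1) - p.2 ∈ N} = 0 := by
    rw [Measure.measure_prod_null hm]
    refine Filter.Eventually.of_forall fun s => ?_
    exact ((Measure.measurePreserving_sub_left volume (φ (e s))).measure_preimage
      hN.nullMeasurableSet).trans hN0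
  have h1 : (volume.prod volume) {p : ℝ × ℝ | φ (e p.2) - p.1 ∈ N} = 0 :=
    (Measure.measurePreserving_swap.measure_preimage hm.nullMeasurableSet).trans h0
  obtain ⟨x, hx⟩ := (Measure.measure_ae_null_of_prod_null h1).exists
  have hx : volume {s | φ (e s) - x ∈ N} = 0 := hx
  refine ⟨x, {a | φ a - x ∉ N}, ?_, fun hc => ?_, fun a ha h => ha (subset_toMeasurable _ _ h)⟩
  · exact hN.compl.preimage (f := fun a => φ a - x) (hφ.measurable.sub_const x)
  · have hc' : volume {s | φ (e s) - x ∈ N}ᶜ = 0 :=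
      (hc.preimage e.injective).measure_zero volume
    have := measure_union_null hx hc'
    rw [union_compl_self] at this
    simp at this

theorem dense_compl_singleton_natBool (p : ℕ → Bool) : Dense ({p}ᶜ : Set (ℕ → Bool)) := by
  intro q
  by_cases h : q = p
  · subst h
    refine mem_closure_of_tendsto (f := fun n => Function.update q n (!q n)) (b := Filter.atTop)
      ?_ (Filter.Eventually.of_forall fun n h => ?_)
    · refine tendsto_pi_nhds.2 fun i => tendsto_const_nhds.congr' ?_
      filter_upwards [Filter.eventually_gt_atTop i] with n hn
      rw [Function.update_of_ne hn.ne]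
    · simpa using congrFun h n
  · exact subset_closure h

/-- A generic `x` works at every point of a countable dense set, so the good points contain a dense
Gδ, uncountable by Baire since there are no isolated points. -/
theorem exists_measurableSet_not_countable_of_isMeagre {φ : (ℕ → Bool) → ℝ}
    (hφ : Continuous φ) {Z : Set ℝ} (hZ : IsMeagre Z) :
    ∃ (x : ℝ) (B : Set (ℕ → Bool)), MeasurableSet B ∧ ¬ B.Countable ∧ ∀ a ∈ B, φ a - x ∉ Z := by
  obtain ⟨S, hSo, hSd, hSc, hSZ⟩ := mem_residual_iff.1 hZ
  let d := TopologicalSpace.denseSeq (ℕ → Bool)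
  have hd : DenseRange d := TopologicalSpace.denseRange_denseSeq _
  obtain ⟨x, hx⟩ : (⋂ n, ⋂ s ∈ S, (fun x => φ (d n) - x) ⁻¹' s).Nonempty := by
    refine (dense_iInter_of_Gδ (fun n => ?_) fun n => ?_).nonempty
    · exact IsGδ.biInter_of_isOpen hSc fun s hs => (hSo s hs).preimage (by fun_prop)
    · refine dense_biInter_of_isOpen (fun s hs => (hSo s hs).preimage (by fun_prop)) hSc
        fun s hs => ?_
      exact (hSd s hs).preimage (Homeomorph.subLeft (φ (d n))).isOpenMap
  simp only [mem_iInter, mem_preimage] at hx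
  have hφx : Continuous fun a => φ a - x := by fun_prop
  refine ⟨x, ⋂ s ∈ S, (fun a => φ a - x) ⁻¹' s, ?_, fun hc => ?_, fun a ha => ?_⟩
  · exact MeasurableSet.biInter hSc fun s hs => ((hSo s hs).preimage hφx).measurableSet
  · have h1 : Dense (⋂ s ∈ S, (fun a => φ a - x) ⁻¹' s) :=
      hd.mono (by rintro _ ⟨n, rfl⟩; simpa using hx n)
    have h2 : Dense (⋂ p ∈ ⋂ s ∈ S, (fun a => φ a - x) ⁻¹' s, ({p}ᶜ : Set (ℕ → Bool))) :=
      dense_biInter_of_isOpen (fun p _ => isOpen_compl_singleton) hc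
        fun p _ => dense_compl_singleton_natBool p
    obtain ⟨p, hp1, hp2⟩ := (h1.inter_of_Gδ
      (IsGδ.biInter_of_isOpen hSc fun s hs => (hSo s hs).preimage hφx)
      (IsGδ.biInter_of_isOpen hc fun p _ => isOpen_compl_singleton) h2).nonempty
    exact mem_iInter₂.1 hp2 p hp1 rfl
  · exact hSZ (mem_sInter.2 fun s hs => mem_iInter₂.1 ha s hs)

theorem continuous_cantorFunction {c : ℝ} (h0 : 0 ≤ c) (h1 : c < 1) :
    Continuous (cantorFunction c) := by
  refine continuous_tsum (fun n => ?_) (summable_geometric_of_lt_one h0 h1) fun n f => ?_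
  · exact (continuous_of_discreteTopology (f := fun b : Bool => cond b (c ^ n) 0)).comp
      (continuous_apply n)
  · rw [Real.norm_of_nonneg (cantorFunctionAux_nonneg h0)]
    cases h : f n <;> simp [h, pow_nonneg h0]

/-- There are two continuous maps from the Cantor space to the line whose pointwise sum is injective
on the product. -/
theorem exists_continuous_injective_add : ∃ t k : (ℕ → Bool) → ℝ, Continuous t ∧ Continuous k ∧
    Function.Injective fun p : (ℕ → Bool) × (ℕ → Bool) => t p.1 + k p.2 := by
  have h0 : (0 : ℝ) ≤ 1 / 3 := by norm_num
  have h1 : (1 / 3 : ℝ) < 1 := by norm_num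
  -- Even and odd ternary digits never overlap, so adding interleaves the sequences; a ratio below
  -- 1/2 gives injectivity.
  let ev : (ℕ → Bool) → ℕ → Bool := fun c n => if n % 2 = 0 then c (n / 2) else false
  let od : (ℕ → Bool) → ℕ → Bool := fun c n => if n % 2 = 0 then false else c (n / 2)
  have hev : Continuous ev := continuous_pi fun n => by
    by_cases h : n % 2 = 0 <;> simp only [ev, h, if_true, if_false] <;> fun_prop
  have hod : Continuous od := continuous_pi fun n => by
    by_cases h : n % 2 = 0 <;> simp only [od, h, if_true, if_false] <;> fun_prop
  have hsum : ∀ c a, cantorFunction (1 / 3) (ev c) + cantorFunction (1 / 3) (od a) =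
      cantorFunction (1 / 3) fun n => if n % 2 = 0 then c (n / 2) else a (n / 2) := by
    intro c a
    rw [cantorFunction, cantorFunction, ← (summable_cantor_function _ h0 h1).tsum_add
      (summable_cantor_function _ h0 h1), cantorFunction]
    refine tsum_congr fun n => ?_
    by_cases h : n % 2 = 0 <;> simp [cantorFunctionAux, ev, od, h]
  refine ⟨fun c => cantorFunction (1 / 3) (ev c), fun a => cantorFunction (1 / 3) (od a),
    (continuous_cantorFunction h0 h1).comp hev, (continuous_cantorFunction h0 h1).comp hod, ?_⟩
  rintro ⟨c, a⟩ ⟨c', a'⟩ h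
  simp only [hsum] at h
  have h := cantorFunction_injective (by norm_num) (by norm_num) h
  refine Prod.ext (funext fun n => ?_) (funext fun n => ?_)
  · simpa using congrFun h (2 * n)
  · have hn : (2 * n + 1) / 2 = n := by omega
    have hn' : (2 * n + 1) % 2 = 1 := by omega
    simpa [hn, hn'] using congrFun h (2 * n + 1)

theorem mainTheorem2 :
    ∃ E : Set ℝ, MeasureTheory.AnalyticSet E ∧
      ∀ Z : Set ℝ, MeasureTheory.volume Z = 0 ∨ IsMeagre Z →
        ∃ x : ℝ, ¬ @MeasurableSet ℝ (borel ℝ) (E \ ((fun z : ℝ => x + z) '' Z)) := by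
  obtain ⟨U, hU, huniv⟩ := exists_universal_analyticSet (ℕ → Bool)
  obtain ⟨t, k, ht, hk, hinj⟩ := exists_continuous_injective_add
  refine ⟨(fun p : (ℕ → Bool) × (ℕ → Bool) => t p.1 + k p.2) '' U,
    hU.image_of_continuous (by fun_prop), fun Z hZ => ?_⟩
  obtain ⟨x, B, hB, hBc, hBZ⟩ : ∃ (x : ℝ) (B : Set (ℕ → Bool)),
      MeasurableSet B ∧ ¬ B.Countable ∧ ∀ a ∈ B, k a - x ∉ Z :=
    hZ.elim (exists_measurableSet_not_countable_of_volume_eq_zero hk)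
      (exists_measurableSet_not_countable_of_isMeagre hk)
  obtain ⟨A, hAB, hA, hAm⟩ := hB.exists_analyticSet_subset_not_measurableSet hBc
  obtain ⟨c, rfl⟩ := huniv A hA
  refine ⟨t c + x, fun hm => hAm ?_⟩
  rw [← BorelSpace.measurable_eq (α := ℝ)] at hm
  have hg : Measurable fun a => t c + k a := hk.measurable.const_add _
  convert (hg hm).inter hB using 1
  ext a
  constructor
  · refine fun h => ⟨⟨⟨(c, a), h, rfl⟩, ?_⟩, hAB h⟩
    rintro ⟨z, hz, hza⟩
    have hza : t c + x + z = t c + k a := hza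
    exact hBZ a (hAB h) (by rwa [show k a - x = z by linarith])
  · rintro ⟨⟨⟨p, hp, hpa⟩, -⟩, -⟩
    -- Injectivity keeps the other sections of `U` from contributing here.
    obtain rfl : p = (c, a) := hinj hpa
    exact hp
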